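/- Let $V$ be a finite set and let $G$ be a polytree on $V$, i.e. a directed acyclic graph whose skeleton (the undirected graph obtained by forgetting the directions of the edges) is a tree. Let $(X_v)_{v\in V}\sim N(\mu,\Sigma)$ be a Gaussian vector with positive definite covariance matrix $\Sigma$ which factors according to $G$: for all pairwise disjoint $A,B,Z\subseteq V$, the subvectors $(X_v)_{v\in A}$ and $(X_v)_{v\in B}$ are conditionally independent given $(X_v)_{v\in Z}$ whenever $A$ and $B$ are d-separated given $Z$ in $G$. For $Z\subseteq V$ put $\sigma_{ij|Z}=\sigma_{ij}-\Sigma_{iZ}\Sigma_{ZZ}^{-1}\Sigma_{Zj}$, and let $\rho^2_{ac|Z}=\sigma_{ac|Z}^2/(\sigma_{aa|Z}\,\sigma_{cc|Z})$ be the squared partial correlation coefficient (read as $0$ if the denominator vanishes, i.e. if $a\in Z$ or $c\in Z$). Let $a,b,c\in V$ with $a\ne c$ and $c\ne b$, where $a$ is an ancestor of $c$ and $c$ is an ancestor of $b$, and let $z\in V$ be a vertex with $\rho^2_{ac|bz}\ne\rho^2_{ac|b}$. Then 1. $\rho^2_{ac|bz}>\rho^2_{ac|b}$ if and only if $X_a$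 and $X_z$ are independent and $X_c$ and $X_z$ are not independent; 2. $\rho^2_{ac|bz}<\rho^2_{ac|b}$ if and only if $X_c$ and $X_z$ are independent or $X_a$ and $X_z$ are not independent. -/

import Mathlib

open MeasureTheory ProbabilityTheory

/-- A DAG: a directed graph without directed cycles. -/
def IsDAG {V : Type*} (G : Digraph V) : Prop :=
  ∀ v, ¬ Relation.TransGen G.Adj v v

/-- A polytree: a DAG whose skeleton (the simple graph obtained by forgetting the directions of the
edges) is a tree. -/
structure IsPolytree {V : Type*} (G : Digraph V) : Prop where
  isDAG : IsDAG G
  isTree_skeleton : G.toSimpleGraphInclusive.IsTree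

/-- The set `an(x)` of ancestors of `x`; it contains `x` itself. -/
def ancestors {V : Type*} (G : Digraph V) (x : V) : Set V :=
  {y | Relation.ReflTransGen G.Adj y x}

/-- The set `an(Z)`, the union of the sets `an(z)` for `z ∈ Z`. -/
def ancestorsOf {V : Type*} (G : Digraph V) (Z : Set V) : Set V :=
  ⋃ z ∈ Z, ancestors G z

/-- `v` is a collider on the path `p` of the skeleton: two different edges of `p` at `v` are both
directed towards `v`. -/
def IsCollider {V : Type*} (G : Digraph V) {x y : V} (p : G.toSimpleGraphInclusive.Walk x y)
    (v : V) : Prop :=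
  ∃ u w, u ≠ w ∧ s(u, v) ∈ p.edges ∧ s(w, v) ∈ p.edges ∧ G.Adj u v ∧ G.Adj w v

/-- The path `p` of the skeleton is d-connecting given `Z`: no non-collider on `p` is in `Z`, and
every collider on `p` is in `an(Z)`. -/
def IsDConnecting {V : Type*} (G : Digraph V) {x y : V} (p : G.toSimpleGraphInclusive.Walk x y)
    (Z : Set V) : Prop :=
  p.IsPath ∧ (∀ v ∈ p.support, ¬ IsCollider G p v → v ∉ Z) ∧
    (∀ v ∈ p.support, IsCollider G p v → v ∈ ancestorsOf G Z)

/-- The sets `X` and `Y` are d-separated given `Z`: there is no d-connecting path given `Z` between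
a vertex of `X` and a vertex of `Y`. -/
def DSeparated {V : Type*} (G : Digraph V) (X Y Z : Set V) : Prop :=
  ∀ x ∈ X, ∀ y ∈ Y, ∀ p : G.toSimpleGraphInclusive.Walk x y, ¬ IsDConnecting G p Z

/-- The subvector of `ω` with components in `X`. -/
def subvector {V : Type*} (X : Finset V) (ω : EuclideanSpace ℝ V) : X → ℝ :=
  fun i => ω i

theorem measurable_subvector {V : Type*} [Fintype V] (X : Finset V) :
    Measurable (subvector X) := by
  unfold subvector
  fun_prop

/-- The law `P` of a random vector indexed by the vertices factors according to the directed
graph `G`: for disjoint sets `X`, `Y`, `Z` of vertices, the subvectors on `X` and `Y` are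
conditionally independent given the subvector on `Z` whenever `X` and `Y` are d-separated
given `Z`. -/
def FactorsAccordingTo {V : Type*} [Fintype V] (P : Measure (EuclideanSpace ℝ V))
    [IsFiniteMeasure P] (G : Digraph V) : Prop :=
  ∀ X Y Z : Finset V, Disjoint X Y → Disjoint X Z → Disjoint Y Z → DSeparated G X Y Z →
    CondIndepFun (MeasurableSpace.comap (subvector Z) inferInstance)
      (measurable_subvector Z).comap_le (subvector X) (subvector Y) P

/-- The conditional covariance `σ_ij - Σ_iZ Σ_ZZ⁻¹ Σ_Zj`. -/
noncomputable def condCov {V : Type*} [DecidableEq V] (S : Matrix V V ℝ) (i j : V)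
    (Z : Finset V) : ℝ :=
  S i j - (fun k : Z => S i k) ⬝ᵥ
    Matrix.mulVec (S.submatrix (fun k : Z => (k : V)) (fun k : Z => (k : V)))⁻¹ (fun k : Z => S k j)

/-- The squared partial correlation coefficient of the components `a` and `c` given `Z`. -/
noncomputable def sqPartialCorr {V : Type*} [DecidableEq V] (S : Matrix V V ℝ) (a c : V)
    (Z : Finset V) : ℝ :=
  condCov S a c Z ^ 2 / (condCov S a a Z * condCov S c c Z)

/-! The skeleton is a tree, so `z` is attached to the directed path from `a` through `c` to `b` at a
single vertex `w`. Write ρ for correlations. On a path through `w`, d-separation becomes algebra: if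
`w` is no collider, conditioning on it blocks the path and ρ_xy = ρ_xw ρ_wy; if `w` is a collider,
the path is blocked already and ρ_xy = 0. Hence `FactorsAccordingTo.covariance_cases`, with four
shapes: `w` between `a` and `c`, or strictly after `c`, without a collision between `z` and `a`; or
a collision at `w`, at or before `c`, or after `c`.

Squared partial correlations depend only on the correlation matrix, so in each shape both sides are
rational functions of at most four correlations. Three shapes give ρ²_{ac|bz} ≤ ρ²_{ac|b}. A
collision at or before `c` gives the reverse: `z` is then independent of `a` but explains part of
the variance of `c`.

Faithfulness is not assumed, so covariances may vanish by accident. If `z` is uncorrelated with `a`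
but correlated with `c` in a shape without collision, then ρ_ac = 0, hence ρ_{ac|b} = 0, and the
required inequality is trivial. The conditions in the two equivalences are complementary, so weak
inequalities together with ρ²_{ac|bz} ≠ ρ²_{ac|b} suffice. -/

/-- The conditional expectation of a product of conditionally independent square integrable
variables is the product of the conditional expectations; integrated form. -/
theorem integral_mul_eq_of_condIndepFun {Ω : Type*} {m mΩ : MeasurableSpace Ω}
    [StandardBorelSpace Ω] {P : Measure Ω} [IsFiniteMeasure P] (hm : m ≤ mΩ) {X Y X' Y' : Ω → ℝ}
    (hX : Measurable X) (hY : Measurable Y) (hX2 : MemLp X 2 P) (hY2 : MemLp Y 2 P)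
    (h : CondIndepFun m hm X Y P) (hX' : P[X|m] =ᵐ[P] X') (hY' : P[Y|m] =ᵐ[P] Y') :
    ∫ ω, X ω * Y ω ∂P = ∫ ω, X' ω * Y' ω ∂P := by
  have hXY : Integrable (fun ω => X ω * Y ω) P := hX2.integrable_mul hY2
  rw [condIndepFun_iff_map_prod_eq_prod_map_map hX hY] at h
  have h' := ae_of_ae_trim hm h
  rw [← integral_condExp hm (f := fun ω => X ω * Y ω)]
  apply integral_congr_ae
  filter_upwards [h', hX', hY', condExp_ae_eq_integral_condExpKernel hm hXY,
    condExp_ae_eq_integral_condExpKernel hm (hX2.integrable one_le_two),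
    condExp_ae_eq_integral_condExpKernel hm (hY2.integrable one_le_two)] with ω h0 h1 h2 h3 h4 h5
  have hi : IndepFun X Y (condExpKernel P m ω) := by
    rw [indepFun_iff_map_prod_eq_prod_map_map hX.aemeasurable hY.aemeasurable]
    rw [Kernel.map_apply _ (hX.prodMk hY), Kernel.prod_apply, Kernel.map_apply _ hX,
      Kernel.map_apply _ hY] at h0
    exact h0
  rw [h3, hi.integral_fun_mul_eq_mul_integral hX.aestronglyMeasurable hY.aestronglyMeasurable,
    ← h4, ← h5, h1, h2]

/-! ### Gaussian vectors: from conditional independence to covariance identities. -/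

section Gaussian

variable {V : Type*} [Fintype V] [DecidableEq V] {S : Matrix V V ℝ} {m : EuclideanSpace ℝ V}

theorem hasGaussianLaw_prodMk_eval (L L' : EuclideanSpace ℝ V →L[ℝ] ℝ) :
    HasGaussianLaw (fun ω => (L ω, L' ω)) (multivariateGaussian m S) :=
  (IsGaussian.hasGaussianLaw_id (μ := multivariateGaussian m S)).map_fun (L.prod L')

theorem memLp_two_eval (i : V) :
    MemLp (fun ω : EuclideanSpace ℝ V => ω i) 2 (multivariateGaussian m S) :=
  (hasGaussianLaw_prodMk_eval (EuclideanSpace.proj i) (EuclideanSpace.proj i)).fst.memLp_two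

theorem integral_eval_multivariateGaussian (i : V) :
    ∫ ω, ω i ∂(multivariateGaussian m S) = m i := by
  have := (EuclideanSpace.proj i : EuclideanSpace ℝ V →L[ℝ] ℝ).integral_comp_id_comm
    (IsGaussian.integrable_id (μ := multivariateGaussian m S))
  simpa using this

theorem indepFun_eval_iff (hS : S.PosSemidef) (i j : V) :
    IndepFun (fun ω => ω i) (fun ω => ω j) (multivariateGaussian m S) ↔ S i j = 0 := by
  rw [← covariance_eval_multivariateGaussian (μ := m) hS i j]
  refine ⟨fun h => h.covariance_eq_zero (memLp_two_eval i) (memLp_two_eval j), fun h => ?_⟩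
  exact (hasGaussianLaw_prodMk_eval (EuclideanSpace.proj i)
    (EuclideanSpace.proj j)).indepFun_of_covariance_eq_zero h

theorem integral_sub_mul_sub_multivariateGaussian (hS : S.PosSemidef) (i j : V) :
    ∫ ω, (ω i - m i) * (ω j - m j) ∂(multivariateGaussian m S) = S i j := by
  rw [← covariance_eval_multivariateGaussian (μ := m) hS i j, covariance]
  simp only [integral_eval_multivariateGaussian]

/-- The factorization property conditions on the subvector, the regression formula on the
coordinate; this identifies the two σ-algebras. -/
theorem comap_subvector_singleton {V : Type*} (w : V) :
    MeasurableSpace.comap (subvector {w}) inferInstance =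
      MeasurableSpace.comap (fun ω : EuclideanSpace ℝ V => ω w) inferInstance := by
  apply le_antisymm
  · have : subvector {w} = (fun (t : ℝ) (_ : ({w} : Finset V)) => t) ∘
        fun ω : EuclideanSpace ℝ V => ω w := by
      ext ω ⟨i, hi⟩
      obtain rfl := Finset.mem_singleton.1 hi
      rfl
    rw [this, ← MeasurableSpace.comap_comp]
    exact MeasurableSpace.comap_mono (measurable_pi_lambda _ fun _ => measurable_id).comap_le
  · have : (fun ω : EuclideanSpace ℝ V => ω w) =
      (fun f : ({w} : Finset V) → ℝ => f ⟨w, by simp⟩) ∘ subvector {w} := rfl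
    rw [this, ← MeasurableSpace.comap_comp]
    exact MeasurableSpace.comap_mono (measurable_pi_apply _).comap_le

/-- Linear regression of one component of a Gaussian vector on another. -/
theorem condExp_eval_sub (hS : S.PosSemidef) {w : V} (hw : S w w ≠ 0) (i : V) :
    (multivariateGaussian m S)[fun ω => ω i - m i |
      MeasurableSpace.comap (fun ω : EuclideanSpace ℝ V => ω w) inferInstance]
      =ᵐ[multivariateGaussian m S] fun ω => S i w / S w w * (ω w - m w) := by
  set P := multivariateGaussian m S
  set β := S i w / S w w
  have hwm : Measurable (fun ω : EuclideanSpace ℝ V => ω w) := by fun_prop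
  have hint (j : V) : Integrable (fun ω : EuclideanSpace ℝ V => ω j) P :=
    (memLp_two_eval j).integrable one_le_two
  -- The regression residual is uncorrelated with the component `w`, hence independent of it by
  -- joint Gaussianity, so its conditional expectation is constant.
  let r : EuclideanSpace ℝ V → ℝ := fun ω => ω i - β * ω w
  have hr : Measurable r := by fun_prop
  have hind : IndepFun r (fun ω => ω w) P := by
    refine (hasGaussianLaw_prodMk_eval (EuclideanSpace.proj i - β • EuclideanSpace.proj w)
      (EuclideanSpace.proj w)).indepFun_of_covariance_eq_zero ?_
    change cov[fun ω : EuclideanSpace ℝ V => ω i - β * ω w, fun ω => ω w; P] = 0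
    rw [covariance_fun_sub_left (memLp_two_eval i) ((memLp_two_eval w).const_mul β)
      (memLp_two_eval w), covariance_const_mul_left, covariance_eval_multivariateGaussian hS,
      covariance_eval_multivariateGaussian hS]
    simp [β, div_mul_cancel₀ _ hw]
  have h1 := condExp_indep_eq hr.comap_le hwm.comap_le
    (comap_measurable r).stronglyMeasurable hind
  have h2 : P[r] = m i - β * m w := by
    simp only [r]
    rw [integral_sub (hint i) ((hint w).const_mul β), integral_const_mul]
    simp only [P, integral_eval_multivariateGaussian]
  have hL : StronglyMeasurable[MeasurableSpace.comap (fun ω : EuclideanSpace ℝ V => ω w)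
      inferInstance] (fun ω : EuclideanSpace ℝ V => β * ω w - m i) :=
    (((comap_measurable (fun ω : EuclideanSpace ℝ V => ω w)).const_mul β).sub_const
      (m i)).stronglyMeasurable
  have hLi : Integrable (fun ω : EuclideanSpace ℝ V => β * ω w - m i) P :=
    ((hint w).const_mul β).sub (integrable_const _)
  have hri : Integrable r P := (hint i).sub ((hint w).const_mul β)
  have h3 : (fun ω : EuclideanSpace ℝ V => ω i - m i) =
      r + fun ω : EuclideanSpace ℝ V => β * ω w - m i := by
    ext ω; simp only [Pi.add_apply, r]; ring
  rw [h3]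
  filter_upwards [condExp_add hri hLi (MeasurableSpace.comap
    (fun ω : EuclideanSpace ℝ V => ω w) inferInstance), h1] with ω ha hb
  rw [ha, Pi.add_apply, hb, h2, condExp_of_stronglyMeasurable hwm.comap_le hL hLi]
  ring

variable {G : Digraph V}

theorem CondIndepFun.eval_sub {x y : V} {m' : MeasurableSpace (EuclideanSpace ℝ V)} {hm'}
    (h : CondIndepFun m' hm' (subvector {x}) (subvector {y}) (multivariateGaussian m S)) :
    CondIndepFun m' hm' (fun ω : EuclideanSpace ℝ V => ω x - m x) (fun ω => ω y - m y)
      (multivariateGaussian m S) :=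
  h.comp (φ := fun f : ({x} : Finset V) → ℝ => f ⟨x, by simp⟩ - m x)
    (ψ := fun f : ({y} : Finset V) → ℝ => f ⟨y, by simp⟩ - m y) (by fun_prop) (by fun_prop)

/-- Given the component `w`, both centred variables have conditional expectations proportional to
its centred value; integrating their product gives S_xw S_yw / S_ww. -/
theorem FactorsAccordingTo.mul_eq_of_dSeparated (hS : S.PosDef)
    (h : FactorsAccordingTo (multivariateGaussian m S) G) {x y w : V} (hxy : x ≠ y) (hxw : x ≠ w)
    (hyw : y ≠ w) (hd : DSeparated G {x} {y} {w}) : S x y * S w w = S x w * S w y := by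
  have hw : S w w ≠ 0 := hS.diag_pos.ne'
  have hc := CondIndepFun.eval_sub (h {x} {y} {w} (by simpa using hxy) (by simpa using hxw)
    (by simpa using hyw) (by simpa using hd))
  have hX (i : V) : MemLp (fun ω : EuclideanSpace ℝ V => ω i - m i) 2 (multivariateGaussian m S) :=
    (memLp_two_eval i).sub (memLp_const _)
  have hE (i : V) := condExp_eval_sub (m := m) hS.posSemidef hw i
  rw [← comap_subvector_singleton] at hE
  have := integral_mul_eq_of_condIndepFun _ (by fun_prop) (by fun_prop) (hX x) (hX y) hc
    (hE x) (hE y)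
  rw [integral_sub_mul_sub_multivariateGaussian hS.posSemidef] at this
  have h2 : ∀ ω : EuclideanSpace ℝ V, S x w / S w w * (ω w - m w) *
      (S y w / S w w * (ω w - m w)) =
      (S x w / S w w * (S y w / S w w)) * ((ω w - m w) * (ω w - m w)) := fun ω => by ring
  simp only [h2] at this
  rw [integral_const_mul, integral_sub_mul_sub_multivariateGaussian hS.posSemidef] at this
  have hsym : S w y = S y w := by simpa using hS.isHermitian.apply y w
  rw [this, hsym]
  field_simp

theorem FactorsAccordingTo.eq_zero_of_dSeparated (hS : S.PosDef)
    (h : FactorsAccordingTo (multivariateGaussian m S) G) {x y : V} (hxy : x ≠ y)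
    (hd : DSeparated G {x} {y} ∅) : S x y = 0 := by
  have hc := CondIndepFun.eval_sub (h {x} {y} ∅ (by simpa using hxy) (by simp) (by simp)
    (by simpa using hd))
  have hX (i : V) : MemLp (fun ω : EuclideanSpace ℝ V => ω i - m i) 2 (multivariateGaussian m S) :=
    (memLp_two_eval i).sub (memLp_const _)
  -- Conditioning on the empty subvector is conditioning on the trivial σ-algebra, so the centred
  -- variables have conditional expectation 0.
  have hbot : MeasurableSpace.comap (subvector (∅ : Finset V)) inferInstance = ⊥ := by
    have : subvector (∅ : Finset V) = fun _ => 0 := by ext ω ⟨i, hi⟩; simp at hi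
    rw [this, MeasurableSpace.comap_const]
  have hE (i : V) : (multivariateGaussian m S)[fun ω : EuclideanSpace ℝ V => ω i - m i |
      MeasurableSpace.comap (subvector (∅ : Finset V)) inferInstance]
      =ᵐ[multivariateGaussian m S] fun _ => 0 := by
    rw [hbot, condExp_bot, integral_sub ((memLp_two_eval i).integrable one_le_two)
      (integrable_const _), integral_eval_multivariateGaussian]
    simp
  have := integral_mul_eq_of_condIndepFun _ (by fun_prop) (by fun_prop) (hX x) (hX y) hc
    (hE x) (hE y)
  rw [integral_sub_mul_sub_multivariateGaussian hS.posSemidef] at this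
  simpa using this

end Gaussian

open SimpleGraph

/-! ### Directed walks and d-separation in polytrees. -/

section Graph

variable {V : Type*} {G : Digraph V}

/-- A walk in the skeleton all of whose edges are traversed in their direction. -/
def IsDirectedWalk (G : Digraph V) {x y : V} (p : G.toSimpleGraphInclusive.Walk x y) : Prop :=
  ∀ d ∈ p.darts, G.Adj d.fst d.snd

theorem IsDAG.not_adj_self (hG : IsDAG G) (x : V) : ¬ G.Adj x x :=
  fun h => hG x (.single h)

theorem IsDirectedWalk.reflTransGen {x y v : V} {p : G.toSimpleGraphInclusive.Walk x y}
    (hp : IsDirectedWalk G p) (hv : v ∈ p.support) : Relation.ReflTransGen G.Adj x v := by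
  induction p with
  | nil => simp at hv; subst hv; exact .refl
  | cons h p ih =>
    rw [Walk.support_cons, List.mem_cons] at hv
    rcases hv with rfl | hv
    · exact .refl
    · exact .head (hp ⟨(_, _), h⟩ (by simp)) (ih (fun d hd => hp d (by simp [hd])) hv)

theorem IsDirectedWalk.isPath (hG : IsDAG G) {x y : V} {p : G.toSimpleGraphInclusive.Walk x y}
    (hp : IsDirectedWalk G p) : p.IsPath := by
  induction p with
  | nil => simp
  | cons h p ih =>
    have hp' : IsDirectedWalk G p := fun d hd => hp d (by simp [hd])
    rw [Walk.cons_isPath_iff]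
    refine ⟨ih hp', fun hu => ?_⟩
    exact hG _ (.head' (hp ⟨(_, _), h⟩ (by simp)) (hp'.reflTransGen hu))

theorem IsDirectedWalk.append {x y z : V} {p : G.toSimpleGraphInclusive.Walk x y}
    {q : G.toSimpleGraphInclusive.Walk y z} (hp : IsDirectedWalk G p) (hq : IsDirectedWalk G q) :
    IsDirectedWalk G (p.append q) := by
  intro d hd
  rw [Walk.darts_append, List.mem_append] at hd
  exact hd.elim (hp d) (hq d)

theorem exists_isDirected (hG : IsDAG G) {x y : V} (h : x ∈ ancestors G y) :
    ∃ p : G.toSimpleGraphInclusive.Walk x y, IsDirectedWalk G p := by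
  induction h using Relation.ReflTransGen.head_induction_on with
  | refl => exact ⟨.nil, by simp [IsDirectedWalk]⟩
  | head h _ ih =>
    obtain ⟨p, hp⟩ := ih
    have hadj : G.toSimpleGraphInclusive.Adj _ _ :=
      ⟨fun he => hG.not_adj_self _ (he ▸ h), Or.inl h⟩
    refine ⟨.cons hadj p, fun d hd => ?_⟩
    rw [Walk.darts_cons, List.mem_cons] at hd
    rcases hd with rfl | hd
    · exact h
    · exact hp d hd

/-- A directed walk has no edge into its first vertex. -/
theorem IsDirectedWalk.not_adj_start (hG : IsDAG G) {x y v : V}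
    {p : G.toSimpleGraphInclusive.Walk x y} (hp : IsDirectedWalk G p) (hv : s(v, x) ∈ p.edges) :
    ¬ G.Adj v x :=
  fun h => hG x (.tail' (hp.reflTransGen (p.fst_mem_support_of_mem_edges hv)) h)

/-- A nontrivial directed walk has an edge into its last vertex. -/
theorem IsDirectedWalk.exists_adj_end {x y : V} {p : G.toSimpleGraphInclusive.Walk x y}
    (hp : IsDirectedWalk G p) (hxy : x ≠ y) : ∃ v, s(v, y) ∈ p.edges ∧ G.Adj v y := by
  induction p with
  | nil => exact absurd rfl hxy
  | @cons u v w h p ih =>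
    have hp' : IsDirectedWalk G p := fun d hd => hp d (by simp [hd])
    by_cases hvw : v = w
    · subst hvw
      exact ⟨u, by simp, hp ⟨(_, _), h⟩ (by simp)⟩
    · obtain ⟨t, ht, ht'⟩ := ih hp' hvw
      exact ⟨t, by simp [ht], ht'⟩

/-- If the concatenation of two paths at `w` is a path on which `w` is not a collider, then `w`
d-separates the end points. -/
theorem IsPolytree.dSeparated_singleton (hG : IsPolytree G) {x w y : V}
    {p : G.toSimpleGraphInclusive.Walk x w} {q : G.toSimpleGraphInclusive.Walk w y}
    (hpq : (p.append q).IsPath)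
    (h : ∀ u v, s(u, w) ∈ p.edges → s(v, w) ∈ q.edges → G.Adj u w → ¬ G.Adj v w) :
    DSeparated G {x} {y} {w} := by
  rintro _ rfl _ rfl r ⟨hr, hr', -⟩
  have : r = p.append q := congrArg Subtype.val
    ((hG.isTree_skeleton.isAcyclic.subsingleton_path _ _).elim ⟨r, hr⟩ ⟨p.append q, hpq⟩)
  subst this
  refine hr' w (by simp) ?_ rfl
  rintro ⟨u, v, huv, hu, hv, hu', hv'⟩
  rw [Walk.edges_append, List.mem_append] at hu hv
  -- A path has only one edge at an end point, so the two colliding edges cannot both lie on `p` or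
  -- both on `q`.
  have hp := hpq.of_append_left
  have hq := hpq.of_append_right
  rcases hu with hu | hu <;> rcases hv with hv | hv
  · rw [Sym2.eq_swap] at hu hv
    exact huv ((hp.eq_penultimate_of_mem_edges hu).trans (hp.eq_penultimate_of_mem_edges hv).symm)
  · exact h u v hu hv hu' hv'
  · exact h v u hv hu hv' hu'
  · rw [Sym2.eq_swap] at hu hv
    exact huv ((hq.eq_snd_of_mem_edges hu).trans (hq.eq_snd_of_mem_edges hv).symm)

/-- If the concatenation of two paths at `w` is a path on which `w` is a collider, then the
end points are d-separated by the empty set. -/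
theorem IsPolytree.dSeparated_empty (hG : IsPolytree G) {x w y u v : V}
    {p : G.toSimpleGraphInclusive.Walk x w} {q : G.toSimpleGraphInclusive.Walk w y}
    (hpq : (p.append q).IsPath) (hu : s(u, w) ∈ p.edges) (hv : s(v, w) ∈ q.edges)
    (hu' : G.Adj u w) (hv' : G.Adj v w) : DSeparated G {x} {y} ∅ := by
  rintro _ rfl _ rfl r ⟨hr, -, hr'⟩
  have : r = p.append q := congrArg Subtype.val
    ((hG.isTree_skeleton.isAcyclic.subsingleton_path _ _).elim ⟨r, hr⟩ ⟨p.append q, hpq⟩)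
  subst this
  have huv : u ≠ v := by
    rintro rfl
    have := hpq.isTrail.edges_nodup
    rw [Walk.edges_append, List.nodup_append'] at this
    exact this.2.2 hu hv
  have := hr' w (by simp) ⟨u, v, huv, by simp [hu], by simp [hv], hu', hv'⟩
  simp [ancestorsOf] at this

/-- Stop the walk at its first vertex in `A`; shortcutting it to a path only shrinks the support.
This locates the vertex where `z` is attached. -/
theorem exists_isPath_to_set {W : Type*} {H : SimpleGraph W} {A : Set W} {x y : W}
    (r : H.Walk x y) (hy : y ∈ A) :
    ∃ w ∈ A, ∃ p : H.Walk x w, p.IsPath ∧ ∀ v ∈ p.support, v ∈ A → v = w := by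
  classical
  suffices h : ∃ w ∈ A, ∃ p : H.Walk x w, ∀ v ∈ p.support, v ∈ A → v = w by
    obtain ⟨w, hw, p, hp⟩ := h
    exact ⟨w, hw, p.bypass, p.bypass_isPath,
      fun v hv => hp v (p.support_bypass_subset_support hv)⟩
  induction r with
  | nil => exact ⟨_, hy, .nil, by simp⟩
  | @cons u v t h r ih =>
    by_cases hu : u ∈ A
    · exact ⟨u, hu, .nil, by simp⟩
    · obtain ⟨w, hw, p, hp⟩ := ih hy
      refine ⟨w, hw, .cons h p, fun v' hv hvA => ?_⟩
      rw [Walk.support_cons, List.mem_cons] at hv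
      rcases hv with rfl | hv
      · exact absurd hvA hu
      · exact hp v' hv hvA

theorem isPath_append_of_forall_mem_support {W : Type*} {H : SimpleGraph W} {x w y : W}
    {p : H.Walk x w} {q : H.Walk w y} (hp : p.IsPath) (hq : q.IsPath)
    (h : ∀ v ∈ p.support, v ∈ q.support → v = w) : (p.append q).IsPath := by
  rw [Walk.isPath_def, Walk.support_append, List.nodup_append']
  refine ⟨hp.support_nodup, hq.support_nodup.tail, fun v hv hv' => ?_⟩
  obtain rfl := h v hv (List.mem_of_mem_tail hv')
  have := hq.support_nodup
  rw [← Walk.cons_tail_support, List.nodup_cons] at this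
  exact this.1 hv'

end Graph

/-! ### Covariances along paths of the polytree. -/

section Tree

variable {V : Type*} [Fintype V] [DecidableEq V] {G : Digraph V} {S : Matrix V V ℝ}
  {m : EuclideanSpace ℝ V}

/-- The factorization property needs disjoint sets; when `w` is an end point the identity is
trivial. -/
theorem FactorsAccordingTo.mul_eq_of_isPath (h : FactorsAccordingTo (multivariateGaussian m S) G)
    (hG : IsPolytree G) (hS : S.PosDef) {x w y : V}
    {p : G.toSimpleGraphInclusive.Walk x w} {q : G.toSimpleGraphInclusive.Walk w y}
    (hpq : (p.append q).IsPath)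
    (hc : ∀ u v, s(u, w) ∈ p.edges → s(v, w) ∈ q.edges → G.Adj u w → ¬ G.Adj v w) :
    S x y * S w w = S x w * S w y := by
  by_cases hxw : x = w
  · subst hxw; ring
  by_cases hyw : y = w
  · subst hyw; ring
  refine h.mul_eq_of_dSeparated hS ?_ hxw hyw (hG.dSeparated_singleton hpq hc)
  rintro rfl
  exact hxw (Walk.nil_append_iff.1 (Walk.isPath_iff_nil.1 hpq)).1.eq

theorem FactorsAccordingTo.mul_eq_of_isDirected
    (h : FactorsAccordingTo (multivariateGaussian m S) G)
    (hG : IsPolytree G) (hS : S.PosDef) {x w y : V}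
    {p : G.toSimpleGraphInclusive.Walk x w} {q : G.toSimpleGraphInclusive.Walk w y}
    (hpq : (p.append q).IsPath) (hq : IsDirectedWalk G q) :
    S x y * S w w = S x w * S w y :=
  h.mul_eq_of_isPath hG hS hpq fun _ _ _ hv _ => hq.not_adj_start hG.isDAG hv

theorem FactorsAccordingTo.eq_zero_of_isPath (h : FactorsAccordingTo (multivariateGaussian m S) G)
    (hG : IsPolytree G) (hS : S.PosDef) {x w y u v : V}
    {p : G.toSimpleGraphInclusive.Walk x w} {q : G.toSimpleGraphInclusive.Walk w y}
    (hpq : (p.append q).IsPath) (hu : s(u, w) ∈ p.edges) (hv : s(v, w) ∈ q.edges)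
    (hu' : G.Adj u w) (hv' : G.Adj v w) : S x y = 0 := by
  refine h.eq_zero_of_dSeparated hS ?_ (hG.dSeparated_empty hpq hu hv hu' hv')
  rintro rfl
  have := Walk.nil_append_iff.1 (Walk.isPath_iff_nil.1 hpq)
  have h1 := this.1.eq
  subst h1
  have h2 := this.1.eq_nil
  subst h2
  simp at hu

/-- The correlation structure of three vertices on a directed path and a further vertex in a
Gaussian polytree model: with `w` the vertex at which `z` is attached to the path, either `w` lies
between `a` and `c` or between `c` and `b` and is no collider between `z` and the path, or it is a
collider. -/
theorem FactorsAccordingTo.covariance_cases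
    (h : FactorsAccordingTo (multivariateGaussian m S) G) (hG : IsPolytree G) (hS : S.PosDef)
    {a b c : V} (ha : a ∈ ancestors G c) (hc : c ∈ ancestors G b) (z : V) :
    S a b * S c c = S a c * S c b ∧
    ((∃ w, S a c * S w w = S a w * S w c ∧ S z a * S w w = S z w * S w a ∧
        S z c * S w w = S z w * S w c ∧ S z b * S c c = S z c * S c b) ∨
      (∃ w, S a w * S c c = S a c * S c w ∧ S c b * S w w = S c w * S w b ∧
        S z a * S w w = S z w * S w a ∧ S z c * S w w = S z w * S w c ∧
        S z b * S w w = S z w * S w b) ∨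
      (S z a = 0 ∧ S z b * S c c = S z c * S c b) ∨
      (S z a = 0 ∧ S z c = 0)) := by
  have hD := hG.isDAG
  obtain ⟨p, hp⟩ := exists_isDirected hD ha
  obtain ⟨q, hq⟩ := exists_isDirected hD hc
  refine ⟨h.mul_eq_of_isDirected hG hS ((hp.append hq).isPath hD) hq, ?_⟩
  obtain ⟨r₀⟩ := hG.isTree_skeleton.connected.preconnected z a
  obtain ⟨w, hw, r, hr, hrA⟩ := exists_isPath_to_set
    (A := {v | v ∈ p.support ∨ v ∈ q.support}) r₀ (by simp)
  by_cases hwp : w ∈ p.support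
  · obtain ⟨p₁, p₂, rfl⟩ := Walk.mem_support_iff_exists_append.1 hwp
    have hp₁ : IsDirectedWalk G p₁ := fun d hd => hp d (by simp [hd])
    have hp₂ : IsDirectedWalk G p₂ := fun d hd => hp d (by simp [hd])
    have hra : (r.append p₁.reverse).IsPath :=
      isPath_append_of_forall_mem_support hr ((Walk.isPath_reverse_iff _).2 (hp₁.isPath hD))
        fun v hv hv' => hrA v hv (Or.inl (by
          rw [Walk.support_reverse, List.mem_reverse] at hv'
          exact (Walk.mem_support_append_iff _ _).2 (Or.inl hv')))
    have hrb : (r.append (p₂.append q)).IsPath :=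
      isPath_append_of_forall_mem_support hr ((hp₂.append hq).isPath hD)
        fun v hv hv' => hrA v hv (by
          rw [Walk.mem_support_append_iff] at hv'
          exact hv'.imp_left fun hv' => (Walk.mem_support_append_iff _ _).2 (Or.inr hv'))
    have hrb' := hrb
    rw [Walk.append_assoc] at hrb'
    have hzb : S z b * S c c = S z c * S c b := h.mul_eq_of_isDirected hG hS hrb' hq
    have hzc : S z c * S w w = S z w * S w c :=
      h.mul_eq_of_isDirected hG hS hrb'.of_append_left hp₂
    -- If the path from `z` enters `w` along an arrow, it collides with the arrow from the `a` side.
    -- Only for `w = a` is there no such arrow.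
    by_cases hin : ∃ u, s(u, w) ∈ r.edges ∧ G.Adj u w
    · obtain ⟨u, hu, hu'⟩ := hin
      by_cases haw : a = w
      · subst haw
        exact Or.inl ⟨a, by ring, by ring, hzc, hzb⟩
      · obtain ⟨v, hv, hv'⟩ := hp₁.exists_adj_end haw
        exact Or.inr (Or.inr (Or.inl
          ⟨h.eq_zero_of_isPath hG hS hra hu (by simpa using hv) hu' hv', hzb⟩))
    · push Not at hin
      exact Or.inl ⟨w, h.mul_eq_of_isDirected hG hS (hp.isPath hD) hp₂,
        h.mul_eq_of_isPath hG hS hra fun u _ hu _ hu' => absurd hu' (hin u hu), hzc, hzb⟩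
  · have hwq := hw.resolve_left hwp
    have hcw : c ≠ w := by rintro rfl; simp at hwp
    obtain ⟨q₁, q₂, rfl⟩ := Walk.mem_support_iff_exists_append.1 hwq
    have hq₁ : IsDirectedWalk G q₁ := fun d hd => hq d (by simp [hd])
    have hq₂ : IsDirectedWalk G q₂ := fun d hd => hq d (by simp [hd])
    have hra : (r.append (p.append q₁).reverse).IsPath :=
      isPath_append_of_forall_mem_support hr
        ((Walk.isPath_reverse_iff _).2 ((hp.append hq₁).isPath hD))
        fun v hv hv' => hrA v hv (by
          rw [Walk.support_reverse, List.mem_reverse, Walk.mem_support_append_iff] at hv'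
          exact hv'.imp_right fun hv' => (Walk.mem_support_append_iff _ _).2 (Or.inl hv'))
    have hrc : (r.append q₁.reverse).IsPath := by
      rw [Walk.reverse_append, Walk.append_assoc] at hra
      exact hra.of_append_left
    have hrb : (r.append q₂).IsPath :=
      isPath_append_of_forall_mem_support hr (hq₂.isPath hD)
        fun v hv hv' => hrA v hv (Or.inr ((Walk.mem_support_append_iff _ _).2 (Or.inr hv')))
    by_cases hin : ∃ u, s(u, w) ∈ r.edges ∧ G.Adj u w
    · obtain ⟨u, hu, hu'⟩ := hin
      obtain ⟨v, hv, hv'⟩ := hq₁.exists_adj_end hcw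
      exact Or.inr (Or.inr (Or.inr
        ⟨h.eq_zero_of_isPath hG hS hra hu (by simp [hv]) hu' hv',
          h.eq_zero_of_isPath hG hS hrc hu (by simpa using hv) hu' hv'⟩))
    · push Not at hin
      refine Or.inr (Or.inl ⟨w, ?_, ?_, ?_, ?_, ?_⟩)
      · exact h.mul_eq_of_isDirected hG hS ((hp.append hq₁).isPath hD) hq₁
      · exact h.mul_eq_of_isDirected hG hS (hq.isPath hD) hq₂
      · exact h.mul_eq_of_isPath hG hS hra fun u _ hu _ hu' => absurd hu' (hin u hu)
      · exact h.mul_eq_of_isPath hG hS hrc fun u _ hu _ hu' => absurd hu' (hin u hu)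
      · exact h.mul_eq_of_isDirected hG hS hrb hq₂

end Tree

/-! ### Partial correlations in terms of the correlation matrix. -/

section CondCov

variable {V : Type*}

/-- Conditional covariances are computed from any solution of the normal equations. -/
theorem condCov_eq_of_normal_equations [DecidableEq V] {S : Matrix V V ℝ} (hS : S.PosDef) (i j : V) (Z : Finset V)
    (β : V → ℝ) (hβ : ∀ l ∈ Z, ∑ k ∈ Z, S l k * β k = S l j) :
    condCov S i j Z = S i j - ∑ k ∈ Z, S i k * β k := by
  have hdet : IsUnit (S.submatrix (fun k : Z => (k : V)) (fun k : Z => (k : V))).det :=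
    (hS.submatrix Subtype.val_injective).det_pos.ne'.isUnit
  have h : (fun k : Z => S k j) =
      (S.submatrix (fun k : Z => (k : V)) (fun k : Z => (k : V))).mulVec fun k => β k := by
    ext l
    rw [← hβ l l.2]
    exact (Finset.sum_coe_sort Z fun k => S l k * β k).symm
  rw [condCov, h, Matrix.mulVec_mulVec, Matrix.nonsing_inv_mul _ hdet, Matrix.one_mulVec]
  congr 1
  exact Finset.sum_coe_sort Z fun k => S i k * β k

/-- The correlation matrix of a covariance matrix. -/
noncomputable def corrMatrix (S : Matrix V V ℝ) : Matrix V V ℝ :=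
  Matrix.of fun i j => S i j / (√(S i i) * √(S j j))

variable {S : Matrix V V ℝ}

theorem eq_mul_corrMatrix (hS : S.PosDef) (i j : V) :
    S i j = √(S i i) * √(S j j) * corrMatrix S i j := by
  have hi := Real.sqrt_pos.2 (hS.diag_pos (i := i))
  have hj := Real.sqrt_pos.2 (hS.diag_pos (i := j))
  rw [corrMatrix, Matrix.of_apply]
  field_simp

/-- Hides the square roots behind positive atoms `d i`, so that `field_simp` and `ring` can work. -/
theorem exists_eq_mul_corrMatrix (hS : S.PosDef) : ∃ d : V → ℝ, (∀ i, 0 < d i) ∧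
    (∀ i, √(S i i) = d i) ∧ ∀ i j, S i j = d i * d j * corrMatrix S i j :=
  ⟨fun i => √(S i i), fun _ => Real.sqrt_pos.2 hS.diag_pos, fun _ => rfl, eq_mul_corrMatrix hS⟩

theorem corrMatrix_self (hS : S.PosDef) (i : V) : corrMatrix S i i = 1 := by
  have hi := hS.diag_pos (i := i)
  rw [corrMatrix, Matrix.of_apply, Real.mul_self_sqrt hi.le, div_self hi.ne']

theorem corrMatrix_comm (hS : S.PosDef) (i j : V) : corrMatrix S i j = corrMatrix S j i := by
  have h : S i j = S j i := by simpa using hS.isHermitian.apply j i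
  simp only [corrMatrix, Matrix.of_apply, h, mul_comm]

theorem corrMatrix_eq_zero_iff (hS : S.PosDef) (i j : V) : corrMatrix S i j = 0 ↔ S i j = 0 := by
  have hi := Real.sqrt_pos.2 (hS.diag_pos (i := i))
  have hj := Real.sqrt_pos.2 (hS.diag_pos (i := j))
  rw [eq_mul_corrMatrix hS i j]
  simp [hi.ne', hj.ne']

theorem corrMatrix_eq_mul (hS : S.PosDef) {x y w : V} (h : S x y * S w w = S x w * S w y) :
    corrMatrix S x y = corrMatrix S x w * corrMatrix S w y := by
  obtain ⟨d, hd, -, hE⟩ := exists_eq_mul_corrMatrix hS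
  have hx := hd x
  have hy := hd y
  have hw := hd w
  rw [hE x y, hE x w, hE w y, hE w w, corrMatrix_self hS] at h
  have : d x * d y * d w * d w *
      (corrMatrix S x y - corrMatrix S x w * corrMatrix S w y) = 0 := by linear_combination h
  rw [mul_eq_zero, sub_eq_zero] at this
  exact this.resolve_left (by positivity)

variable [DecidableEq V]

theorem posDef_corrMatrix [Fintype V] (hS : S.PosDef) : (corrMatrix S).PosDef := by
  have h (i : V) : (√(S i i))⁻¹ ≠ 0 := (inv_pos.2 (Real.sqrt_pos.2 hS.diag_pos)).ne'
  have hU : IsUnit (Matrix.diagonal fun i => (√(S i i))⁻¹) := by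
    rw [Matrix.isUnit_iff_isUnit_det, Matrix.det_diagonal]
    exact (Finset.prod_ne_zero_iff.2 fun i _ => h i).isUnit
  have := (Matrix.IsUnit.posDef_star_left_conjugate_iff hU).2 hS
  convert this using 1
  ext i j
  simp [corrMatrix, Matrix.star_eq_conjTranspose, Matrix.mul_diagonal, Matrix.diagonal_mul]
  ring

theorem corrMatrix_sq_lt_one [Fintype V] (hS : S.PosDef) {i j : V} (hij : i ≠ j) :
    corrMatrix S i j ^ 2 < 1 := by
  have hinj : Function.Injective ![i, j] := by
    intro k l h; fin_cases k <;> fin_cases l <;> simp_all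
  have := ((posDef_corrMatrix hS).submatrix hinj).det_pos
  rw [Matrix.det_fin_two] at this
  simp only [Matrix.submatrix_apply, Matrix.cons_val_zero, Matrix.cons_val_one,
    corrMatrix_self hS, corrMatrix_comm hS j i] at this
  linarith

theorem corrMatrix_sq_le_one [Fintype V] (hS : S.PosDef) (i j : V) :
    corrMatrix S i j ^ 2 ≤ 1 := by
  by_cases hij : i = j
  · simp [hij, corrMatrix_self hS]
  · exact (corrMatrix_sq_lt_one hS hij).le

theorem corrMatrix_sq_add_sq_lt_one [Fintype V] (hS : S.PosDef) {i j k : V} (hij : i ≠ j)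
    (hik : i ≠ k) (hjk : j ≠ k) (h : corrMatrix S j k = 0) :
    corrMatrix S i j ^ 2 + corrMatrix S i k ^ 2 < 1 := by
  have hinj : Function.Injective ![i, j, k] := by
    intro s t h; fin_cases s <;> fin_cases t <;> simp_all
  have := ((posDef_corrMatrix hS).submatrix hinj).det_pos
  rw [Matrix.det_fin_three] at this
  simp only [Matrix.submatrix_apply, Matrix.cons_val_zero, Matrix.cons_val_one, Matrix.cons_val,
    corrMatrix_self hS, corrMatrix_comm hS j i, corrMatrix_comm hS k i, corrMatrix_comm hS k j,
    h] at this
  linarith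

theorem condCov_singleton (hS : S.PosDef) (i j b : V) :
    condCov S i j {b} = √(S i i) * √(S j j) *
      (corrMatrix S i j - corrMatrix S i b * corrMatrix S j b) := by
  obtain ⟨d, hd, hsd, hE⟩ := exists_eq_mul_corrMatrix hS
  have hb := hd b
  rw [hsd, hsd]
  have hbb := hS.diag_pos (i := b)
  rw [condCov_eq_of_normal_equations hS i j {b} (fun _ => S b j / S b b) (by
    intro l hl
    rw [Finset.mem_singleton.1 hl, Finset.sum_singleton]
    field_simp), Finset.sum_singleton, hE i j, hE i b,
    hE b j, hE b b, corrMatrix_self hS, corrMatrix_comm hS b j]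
  field_simp

theorem condCov_pair [Fintype V] (hS : S.PosDef) (i j : V) {b z : V} (hbz : b ≠ z) :
    condCov S i j {b, z} = √(S i i) * √(S j j) *
      (((1 - corrMatrix S b z ^ 2) * corrMatrix S i j - corrMatrix S i b * corrMatrix S j b -
        corrMatrix S i z * corrMatrix S j z + corrMatrix S b z *
          (corrMatrix S i b * corrMatrix S j z + corrMatrix S i z * corrMatrix S j b)) /
      (1 - corrMatrix S b z ^ 2)) := by
  obtain ⟨d, hd, hsd, hE⟩ := exists_eq_mul_corrMatrix hS
  have hb := hd b
  have hz := hd z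
  rw [hsd, hsd]
  have hD : 1 - corrMatrix S b z ^ 2 ≠ 0 := (sub_pos.2 (corrMatrix_sq_lt_one hS hbz)).ne'
  -- Regression coefficients of `j` on `b` and `z`, from Cramer's rule for the 2 × 2 normal
  -- equations.
  let β : V → ℝ := fun k =>
    if k = b then d j / d b *
      ((corrMatrix S j b - corrMatrix S b z * corrMatrix S j z) / (1 - corrMatrix S b z ^ 2))
    else d j / d z *
      ((corrMatrix S j z - corrMatrix S b z * corrMatrix S j b) / (1 - corrMatrix S b z ^ 2))
  have hβb : β b = d j / d b *
      ((corrMatrix S j b - corrMatrix S b z * corrMatrix S j z) / (1 - corrMatrix S b z ^ 2)) :=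
    if_pos rfl
  have hβz : β z = d j / d z *
      ((corrMatrix S j z - corrMatrix S b z * corrMatrix S j b) / (1 - corrMatrix S b z ^ 2)) :=
    if_neg hbz.symm
  rw [condCov_eq_of_normal_equations hS i j {b, z} β (by
    intro l hl
    rw [Finset.sum_pair hbz, hβb, hβz]
    rw [Finset.mem_insert, Finset.mem_singleton] at hl
    rcases hl with rfl | rfl
    · rw [hE l l, hE l z, hE l j,
        corrMatrix_self hS, corrMatrix_comm hS l j]
      field_simp
      ring
    · rw [hE l l, hE l b, hE l j,
        corrMatrix_self hS, corrMatrix_comm hS l j, corrMatrix_comm hS l b]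
      field_simp
      ring), Finset.sum_pair hbz, hβb, hβz, hE i j, hE i b,
    hE i z]
  field_simp
  ring

theorem sqPartialCorr_singleton (hS : S.PosDef) (a b c : V) :
    sqPartialCorr S a c {b} = (corrMatrix S a c - corrMatrix S a b * corrMatrix S c b) ^ 2 /
      ((1 - corrMatrix S a b ^ 2) * (1 - corrMatrix S c b ^ 2)) := by
  have ha := Real.sqrt_pos.2 (hS.diag_pos (i := a))
  have hc := Real.sqrt_pos.2 (hS.diag_pos (i := c))
  have h : √(S a a) ^ 2 * √(S c c) ^ 2 ≠ 0 := by positivity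
  simp only [sqPartialCorr, condCov_singleton hS, corrMatrix_self hS]
  refine Eq.trans ?_ (mul_div_mul_left _ _ h)
  congr 1 <;> ring

theorem sqPartialCorr_pair [Fintype V] (hS : S.PosDef) (a c : V) {b z : V} (hbz : b ≠ z) :
    sqPartialCorr S a c {b, z} =
      ((1 - corrMatrix S b z ^ 2) * corrMatrix S a c - corrMatrix S a b * corrMatrix S c b -
        corrMatrix S a z * corrMatrix S c z + corrMatrix S b z *
          (corrMatrix S a b * corrMatrix S c z + corrMatrix S a z * corrMatrix S c b)) ^ 2 /
      ((1 - corrMatrix S b z ^ 2 - corrMatrix S a b ^ 2 - corrMatrix S a z ^ 2 +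
          2 * corrMatrix S b z * corrMatrix S a b * corrMatrix S a z) *
        (1 - corrMatrix S b z ^ 2 - corrMatrix S c b ^ 2 - corrMatrix S c z ^ 2 +
          2 * corrMatrix S b z * corrMatrix S c b * corrMatrix S c z)) := by
  have ha := Real.sqrt_pos.2 (hS.diag_pos (i := a))
  have hc := Real.sqrt_pos.2 (hS.diag_pos (i := c))
  have hD : 1 - corrMatrix S b z ^ 2 ≠ 0 := (sub_pos.2 (corrMatrix_sq_lt_one hS hbz)).ne'
  have h : √(S a a) ^ 2 * √(S c c) ^ 2 * (1 - corrMatrix S b z ^ 2)⁻¹ ^ 2 ≠ 0 := by positivity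
  simp only [sqPartialCorr, condCov_pair hS _ _ hbz, corrMatrix_self hS]
  refine Eq.trans ?_ (mul_div_mul_left _ _ h)
  congr 1 <;> ring

end CondCov

/-! ### The four elementary inequalities, one for each shape. -/

section Inequalities

/-- Here p = ρ_aw, q = ρ_wc, s = ρ_cb, t = ρ_zw. The numerator is the square of pq(1 - s²)(1 - t²),
and the denominator is `A` times (1 - s²)(1 - t²q²), with `A` ≥ (1 - t²)(1 - p²q²s²). -/
theorem partialCorr_le_of_star {p q s t : ℝ} (hp : p ^ 2 ≤ 1) (hq : q ^ 2 ≤ 1) (hs : s ^ 2 < 1)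
    (ht : t ^ 2 ≤ 1) :
    ((1 - (t * q * s) ^ 2) * (p * q) - p * q * s * s - t * p * (t * q) +
        t * q * s * (p * q * s * (t * q) + t * p * s)) ^ 2 /
      ((1 - (t * q * s) ^ 2 - (p * q * s) ^ 2 - (t * p) ^ 2 +
          2 * (t * q * s) * (p * q * s) * (t * p)) *
        (1 - (t * q * s) ^ 2 - s ^ 2 - (t * q) ^ 2 + 2 * (t * q * s) * s * (t * q))) ≤
    (p * q - p * q * s * s) ^ 2 / ((1 - (p * q * s) ^ 2) * (1 - s ^ 2)) := by
  set A := 1 - (t * q * s) ^ 2 - (p * q * s) ^ 2 - (t * p) ^ 2 +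
    2 * (t * q * s) * (p * q * s) * (t * p) with hA
  have hC : 1 - (t * q * s) ^ 2 - s ^ 2 - (t * q) ^ 2 + 2 * (t * q * s) * s * (t * q) =
    (1 - s ^ 2) * (1 - t ^ 2 * q ^ 2) := by ring
  have hN : (1 - (t * q * s) ^ 2) * (p * q) - p * q * s * s - t * p * (t * q) +
      t * q * s * (p * q * s * (t * q) + t * p * s) =
      p * q * (1 - s ^ 2) * (1 - t ^ 2) := by ring
  rw [hC, hN]
  have hpq : p ^ 2 * q ^ 2 ≤ 1 := mul_le_one₀ hp (sq_nonneg q) hq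
  have hpqs : p ^ 2 * q ^ 2 * s ^ 2 < 1 :=
    (mul_le_of_le_one_left (sq_nonneg s) hpq).trans_lt hs
  have hqs : q ^ 2 * s ^ 2 ≤ 1 := mul_le_one₀ hq (sq_nonneg s) hs.le
  have htq : t ^ 2 * q ^ 2 ≤ t ^ 2 := mul_le_of_le_one_right (sq_nonneg t) hq
  have hA' : (1 - t ^ 2) * (1 - p ^ 2 * q ^ 2 * s ^ 2) ≤ A := by
    have : 0 ≤ t ^ 2 * (1 - p ^ 2) * (1 - q ^ 2 * s ^ 2) :=
      mul_nonneg (mul_nonneg (sq_nonneg t) (by linarith)) (by linarith)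
    rw [hA]; linarith
  have hB : 0 < (1 - (p * q * s) ^ 2) * (1 - s ^ 2) :=
    mul_pos (by linarith [mul_pow (p * q) s 2, mul_pow p q 2 ▸ mul_pow (p * q) s 2]) (by linarith)
  -- For t² = 1 the denominator may vanish, but the numerator is 0.
  rcases ht.eq_or_lt with ht | ht
  · rw [ht, sub_self, mul_zero]
    simpa using div_nonneg (sq_nonneg _) hB.le
  have hApos : 0 < A := lt_of_lt_of_le (mul_pos (by linarith) (by linarith)) hA'
  rw [div_le_div_iff₀ (mul_pos hApos (mul_pos (by linarith) (by linarith))) hB]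
  have key : (1 - t ^ 2) * ((1 - t ^ 2) * (1 - p ^ 2 * q ^ 2 * s ^ 2)) ≤
      (1 - t ^ 2 * q ^ 2) * A :=
    mul_le_mul (by linarith) hA' (mul_nonneg (by linarith) (by linarith)) (by linarith)
  have := mul_le_mul_of_nonneg_left key
    (mul_nonneg (mul_nonneg (sq_nonneg (p * q)) (sq_nonneg (1 - s ^ 2)))
      (sub_nonneg.2 hs.le))
  linarith

/-- Here p = ρ_ac, q = ρ_cw, s = ρ_wb, t = ρ_zw. The numerator is (p`C`)², so for `C` ≠ 0 the left
side is p²`C`/`A`, to be compared with p²(1 - q²s²)/(1 - p²q²s²). -/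
theorem partialCorr_le_of_proxy {p q s t : ℝ} (hp : p ^ 2 ≤ 1) (hq : q ^ 2 ≤ 1) (hs : s ^ 2 ≤ 1)
    (ht : t ^ 2 ≤ 1) (hqs : (q * s) ^ 2 < 1) :
    ((1 - (t * s) ^ 2) * p - p * q * s * (q * s) - t * (p * q) * (t * q) +
        t * s * (p * q * s * (t * q) + t * (p * q) * (q * s))) ^ 2 /
      ((1 - (t * s) ^ 2 - (p * q * s) ^ 2 - (t * (p * q)) ^ 2 +
          2 * (t * s) * (p * q * s) * (t * (p * q))) *
        (1 - (t * s) ^ 2 - (q * s) ^ 2 - (t * q) ^ 2 + 2 * (t * s) * (q * s) * (t * q))) ≤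
    (p - p * q * s * (q * s)) ^ 2 / ((1 - (p * q * s) ^ 2) * (1 - (q * s) ^ 2)) := by
  set A := 1 - (t * s) ^ 2 - (p * q * s) ^ 2 - (t * (p * q)) ^ 2 +
    2 * (t * s) * (p * q * s) * (t * (p * q)) with hA
  set C := 1 - (t * s) ^ 2 - (q * s) ^ 2 - (t * q) ^ 2 + 2 * (t * s) * (q * s) * (t * q) with hC
  have hN : (1 - (t * s) ^ 2) * p - p * q * s * (q * s) - t * (p * q) * (t * q) +
        t * s * (p * q * s * (t * q) + t * (p * q) * (q * s)) = p * C := by rw [hC]; ring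
  rw [hN]
  have hU : 0 ≤ s ^ 2 * (1 - t ^ 2) + t ^ 2 * (1 - s ^ 2) :=
    add_nonneg (mul_nonneg (sq_nonneg s) (by linarith)) (mul_nonneg (sq_nonneg t) (by linarith))
  have hC0 : 0 ≤ C := by
    have h1 := mul_nonneg (sub_nonneg.2 hs) (sub_nonneg.2 ht)
    have h2 := mul_nonneg (sub_nonneg.2 hq) hU
    rw [hC]; linarith
  have hAC : C ≤ A := by
    have := mul_nonneg (mul_nonneg (sq_nonneg q) (sub_nonneg.2 hp)) hU
    rw [hA, hC]; linarith
  have hpqs : (p * q * s) ^ 2 < 1 := by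
    rw [mul_assoc, mul_pow]
    exact (mul_le_of_le_one_left (sq_nonneg _) hp).trans_lt hqs
  have hB : 0 < (1 - (p * q * s) ^ 2) * (1 - (q * s) ^ 2) :=
    mul_pos (by linarith) (by linarith)
  rcases hC0.eq_or_lt with hC0 | hC0
  · rw [← hC0]
    simpa using div_nonneg (sq_nonneg _) hB.le
  rw [div_le_div_iff₀ (mul_pos (hC0.trans_le hAC) hC0) hB]
  have key : C * (1 - (p * q * s) ^ 2) ≤ A * (1 - (q * s) ^ 2) := by
    have : 0 ≤ q ^ 2 * (1 - p ^ 2) * (t ^ 2 * (1 - s ^ 2) ^ 2) :=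
      mul_nonneg (mul_nonneg (sq_nonneg q) (by linarith)) (by positivity)
    rw [hA, hC]; linarith
  have := mul_le_mul_of_nonneg_left key
    (mul_nonneg (mul_nonneg (sq_nonneg p) hC0.le) (sub_nonneg.2 hqs.le))
  linarith

/-- Here p = ρ_ac, s = ρ_cb, t = ρ_zc. Adding `z` leaves the numerator unchanged and shrinks both
factors of the denominator. -/
theorem le_partialCorr_of_source {p s t : ℝ} (hs : s ^ 2 < 1) (hpt : p ^ 2 + t ^ 2 < 1) :
    (p - p * s * s) ^ 2 / ((1 - (p * s) ^ 2) * (1 - s ^ 2)) ≤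
    ((1 - (t * s) ^ 2) * p - p * s * s - 0 * t + t * s * (p * s * t + 0 * s)) ^ 2 /
      ((1 - (t * s) ^ 2 - (p * s) ^ 2 - 0 ^ 2 + 2 * (t * s) * (p * s) * 0) *
        (1 - (t * s) ^ 2 - s ^ 2 - t ^ 2 + 2 * (t * s) * s * t)) := by
  have hpts : (p ^ 2 + t ^ 2) * s ^ 2 < 1 :=
    (mul_le_of_le_one_left (sq_nonneg s) hpt.le).trans_lt hs
  have hN : (1 - (t * s) ^ 2) * p - p * s * s - 0 * t + t * s * (p * s * t + 0 * s) =
      p - p * s * s := by ring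
  have hC : 1 - (t * s) ^ 2 - s ^ 2 - t ^ 2 + 2 * (t * s) * s * t =
      (1 - s ^ 2) * (1 - t ^ 2) := by ring
  have hA : 0 < 1 - (t * s) ^ 2 - (p * s) ^ 2 - 0 ^ 2 + 2 * (t * s) * (p * s) * 0 := by linarith
  have ht : 0 < 1 - t ^ 2 := by linarith [sq_nonneg p]
  rw [hN, hC]
  refine div_le_div_of_nonneg_left (sq_nonneg _)
    (mul_pos hA (mul_pos (by linarith) ht)) ?_
  refine mul_le_mul ?_ ?_ (mul_nonneg (by linarith) ht.le) ?_
  · linarith [sq_nonneg (t * s)]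
  · exact mul_le_of_le_one_right (by linarith) (by linarith [sq_nonneg t])
  · linarith [sq_nonneg (t * s)]

/-- Here p = ρ_ac, s = ρ_cb, t = ρ_bz. Both sides are p²(x - s²)/(x - p²s²), at x = 1 - t² and at x
= 1; this is nondecreasing in x because p² ≤ 1. -/
theorem partialCorr_le_of_sink {p s t : ℝ} (hp : p ^ 2 ≤ 1) (hst : s ^ 2 + t ^ 2 < 1) :
    ((1 - t ^ 2) * p - p * s * s - 0 * 0 + t * (p * s * 0 + 0 * s)) ^ 2 /
      ((1 - t ^ 2 - (p * s) ^ 2 - 0 ^ 2 + 2 * t * (p * s) * 0) *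
        (1 - t ^ 2 - s ^ 2 - 0 ^ 2 + 2 * t * s * 0)) ≤
    (p - p * s * s) ^ 2 / ((1 - (p * s) ^ 2) * (1 - s ^ 2)) := by
  have hps : (p * s) ^ 2 ≤ s ^ 2 := by
    rw [mul_pow]; exact mul_le_of_le_one_left (sq_nonneg s) hp
  have ht := sq_nonneg t
  have hs := sq_nonneg s
  rw [div_le_div_iff₀ (mul_pos (by linarith) (by linarith)) (mul_pos (by linarith) (by linarith))]
  have key : 0 ≤ t ^ 2 * (s ^ 2 * (1 - p ^ 2)) :=
    mul_nonneg ht (mul_nonneg hs (by linarith))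
  have h : 0 ≤ (p ^ 2 * (1 - t ^ 2 - s ^ 2) * (1 - s ^ 2)) * (t ^ 2 * (s ^ 2 * (1 - p ^ 2))) :=
    mul_nonneg (mul_nonneg (mul_nonneg (sq_nonneg p) (by linarith)) (by linarith)) key
  linarith

end Inequalities

/-! ### Comparison of the two squared partial correlations. -/

section Comparison

variable {V : Type*} [Fintype V] [DecidableEq V] {G : Digraph V} {S : Matrix V V ℝ}
  {m : EuclideanSpace ℝ V}

theorem sqPartialCorr_nonneg (hS : S.PosDef) (a c b : V) :
    0 ≤ sqPartialCorr S a c {b} := by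
  rw [sqPartialCorr_singleton hS]
  exact div_nonneg (sq_nonneg _)
    (mul_nonneg (sub_nonneg.2 (corrMatrix_sq_le_one hS _ _))
      (sub_nonneg.2 (corrMatrix_sq_le_one hS _ _)))

theorem sqPartialCorr_pair_nonneg (hS : S.PosDef) (a c : V) {b z : V} (hbz : b ≠ z) :
    0 ≤ sqPartialCorr S a c {b, z} := by
  -- This is the determinant of the correlation matrix of `i`, `b`, `z`; only semidefiniteness is
  -- used since `i` may equal `b` or `z`.
  have h (i : V) : 0 ≤ 1 - corrMatrix S b z ^ 2 - corrMatrix S i b ^ 2 - corrMatrix S i z ^ 2 +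
      2 * corrMatrix S b z * corrMatrix S i b * corrMatrix S i z := by
    have := ((posDef_corrMatrix hS).posSemidef.submatrix ![i, b, z]).det_nonneg
    rw [Matrix.det_fin_three] at this
    simp only [Matrix.submatrix_apply, Matrix.cons_val_zero, Matrix.cons_val_one, Matrix.cons_val,
      corrMatrix_self hS, corrMatrix_comm hS b i, corrMatrix_comm hS z i,
      corrMatrix_comm hS z b] at this
    linarith
  rw [sqPartialCorr_pair hS a c hbz]
  exact div_nonneg (sq_nonneg _) (mul_nonneg (h a) (h c))

theorem condCov_self_of_mem_pair (hS : S.PosDef) {b z : V} (hbz : b ≠ z) :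
    condCov S z z {b, z} = 0 := by
  rw [condCov_pair hS z z hbz, corrMatrix_self hS, corrMatrix_comm hS z b]
  ring

/-- Along a directed path through `a`, `c`, `b`, observing `z` in addition to `b` does not decrease
the squared partial correlation of `a` and `c` if `z` is independent of `a` and dependent on `c`,
and does not increase it otherwise. -/
theorem FactorsAccordingTo.sqPartialCorr_compare
    (h : FactorsAccordingTo (multivariateGaussian m S) G) (hG : IsPolytree G) (hS : S.PosDef)
    {a b c z : V} (hac : a ≠ c) (hcb : c ≠ b) (hbz : b ≠ z) (ha : a ∈ ancestors G c)
    (hc : c ∈ ancestors G b) :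
    (S a z = 0 → S c z ≠ 0 → sqPartialCorr S a c {b} ≤ sqPartialCorr S a c {b, z}) ∧
    (S a z ≠ 0 ∨ S c z = 0 → sqPartialCorr S a c {b, z} ≤ sqPartialCorr S a c {b}) := by
  by_cases haz : a = z
  · subst haz
    refine ⟨fun h0 => absurd h0 hS.diag_pos.ne', fun _ => ?_⟩
    refine le_of_eq_of_le ?_ (sqPartialCorr_nonneg hS a c b)
    rw [sqPartialCorr, condCov_self_of_mem_pair hS hbz, zero_mul, div_zero]
  obtain ⟨hab, hcases⟩ := h.covariance_cases hG hS ha hc z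
  have hab := corrMatrix_eq_mul hS hab
  have hle := corrMatrix_sq_le_one hS
  have hcb' := corrMatrix_sq_lt_one hS hcb
  rw [ne_eq, ne_eq, ← corrMatrix_eq_zero_iff hS a z, ← corrMatrix_eq_zero_iff hS c z,
    corrMatrix_comm hS a z, corrMatrix_comm hS c z]
  have hzero (h0 : corrMatrix S a c = 0) :
      sqPartialCorr S a c {b} ≤ sqPartialCorr S a c {b, z} := by
    refine le_of_eq_of_le ?_ (sqPartialCorr_pair_nonneg hS a c hbz)
    rw [sqPartialCorr_singleton hS, hab, h0]
    simp
  have hsink (hza : corrMatrix S z a = 0) (hzc : corrMatrix S z c = 0) :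
      sqPartialCorr S a c {b, z} ≤ sqPartialCorr S a c {b} := by
    have hcz : c ≠ z := by
      rintro rfl
      rw [corrMatrix_self hS] at hzc
      exact one_ne_zero hzc
    rw [corrMatrix_comm hS] at hza hzc
    rw [sqPartialCorr_singleton hS, sqPartialCorr_pair hS a c hbz, hab, hza, hzc]
    refine partialCorr_le_of_sink (hle a c) ?_
    rw [corrMatrix_comm hS c b]
    exact corrMatrix_sq_add_sq_lt_one hS hcb.symm hbz hcz hzc
  rcases hcases with ⟨w, hacw, hza, hzc, hzb⟩ | ⟨w, haw, hcbw, hza, hzc, hzb⟩ | ⟨hza, hzb⟩ |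
    ⟨hza, hzc⟩
  · have hacw := corrMatrix_eq_mul hS hacw
    have hza := corrMatrix_eq_mul hS hza
    have hzc := corrMatrix_eq_mul hS hzc
    have hzb := corrMatrix_eq_mul hS hzb
    rw [corrMatrix_comm hS w a] at hza
    refine ⟨fun h1 h2 => hzero ?_, fun _ => ?_⟩
    · rw [hza] at h1
      rw [hzc] at h2
      rw [hacw, (mul_eq_zero.1 h1).resolve_left (left_ne_zero_of_mul h2), zero_mul]
    · rw [sqPartialCorr_singleton hS, sqPartialCorr_pair hS a c hbz, corrMatrix_comm hS b z,
        corrMatrix_comm hS a z, corrMatrix_comm hS c z, hzb, hab, hza, hzc, hacw]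
      exact partialCorr_le_of_star (hle a w) (hle w c) hcb' (hle z w)
  · have haw := corrMatrix_eq_mul hS haw
    have hcbw := corrMatrix_eq_mul hS hcbw
    have hza := corrMatrix_eq_mul hS hza
    have hzc := corrMatrix_eq_mul hS hzc
    have hzb := corrMatrix_eq_mul hS hzb
    rw [corrMatrix_comm hS w a, haw] at hza
    rw [corrMatrix_comm hS w c] at hzc
    refine ⟨fun h1 h2 => hzero ?_, fun _ => ?_⟩
    · rw [hza] at h1
      rw [hzc] at h2
      exact (mul_eq_zero.1 ((mul_eq_zero.1 h1).resolve_left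
        (left_ne_zero_of_mul h2))).resolve_right (right_ne_zero_of_mul h2)
    · rw [hcbw] at hcb'
      rw [hcbw, ← mul_assoc] at hab
      rw [sqPartialCorr_singleton hS, sqPartialCorr_pair hS a c hbz, corrMatrix_comm hS b z,
        corrMatrix_comm hS a z, corrMatrix_comm hS c z, hzb, hab, hza, hzc, hcbw]
      exact partialCorr_le_of_proxy (hle a c) (hle c w) (hle w b) (hle z w) hcb'
  · have hzb := corrMatrix_eq_mul hS hzb
    rw [← corrMatrix_eq_zero_iff hS] at hza
    refine ⟨fun _ h2 => ?_, fun h1 => hsink hza (h1.resolve_left fun h1 => h1 hza)⟩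
    by_cases hcz : c = z
    · exact hzero (by rw [corrMatrix_comm hS, hcz, hza])
    rw [sqPartialCorr_singleton hS, sqPartialCorr_pair hS a c hbz, corrMatrix_comm hS b z,
      corrMatrix_comm hS a z, corrMatrix_comm hS c z, hzb, hab, hza]
    refine le_partialCorr_of_source hcb' ?_
    rw [corrMatrix_comm hS a c, corrMatrix_comm hS z c]
    exact corrMatrix_sq_add_sq_lt_one hS hac.symm hcz haz (by rw [corrMatrix_comm hS, hza])
  · rw [← corrMatrix_eq_zero_iff hS] at hza hzc
    exact ⟨fun _ h2 => absurd hzc h2, fun _ => hsink hza hzc⟩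

end Comparison

theorem theorem9 {V : Type*} [Fintype V] [DecidableEq V] (G : Digraph V) (hG : IsPolytree G)
    (m : EuclideanSpace ℝ V) (S : Matrix V V ℝ) (hS : S.PosDef)
    (hGS : FactorsAccordingTo (multivariateGaussian m S) G)
    (a b c z : V) (hac : a ≠ c) (hcb : c ≠ b)
    (ha : a ∈ ancestors G c) (hc : c ∈ ancestors G b)
    (hne : sqPartialCorr S a c {b, z} ≠ sqPartialCorr S a c {b}) :
    (sqPartialCorr S a c {b, z} > sqPartialCorr S a c {b} ↔
      IndepFun (fun ω => ω a) (fun ω => ω z) (multivariateGaussian m S) ∧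
        ¬ IndepFun (fun ω => ω c) (fun ω => ω z) (multivariateGaussian m S)) ∧
    (sqPartialCorr S a c {b, z} < sqPartialCorr S a c {b} ↔
      IndepFun (fun ω => ω c) (fun ω => ω z) (multivariateGaussian m S) ∨
        ¬ IndepFun (fun ω => ω a) (fun ω => ω z) (multivariateGaussian m S)) := by
  have hbz : b ≠ z := by
    rintro rfl
    exact hne (by rw [Finset.pair_eq_singleton])
  obtain ⟨h1, h2⟩ := hGS.sqPartialCorr_compare hG hS hac hcb hbz ha hc
  rw [indepFun_eval_iff hS.posSemidef, indepFun_eval_iff hS.posSemidef]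
  -- The second condition is the negation of the first, so each sign pattern settles both
  -- equivalences.
  by_cases haz : S a z = 0 <;> by_cases hcz : S c z = 0
  · have := (h2 (Or.inr hcz)).lt_of_ne hne
    simp [haz, hcz, this, this.le]
  · have := (h1 haz hcz).lt_of_ne' hne
    simp [haz, hcz, this, this.le]
  · have := (h2 (Or.inl haz)).lt_of_ne hne
    simp [haz, hcz, this, this.le]
  · have := (h2 (Or.inl haz)).lt_of_ne hne
    simp [haz, hcz, this, this.le]
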